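/- Let $D$ be a division ring with center $F=Z(D)$. Call $D$ weakly locally finite if for every finite subset $S\subseteq D$ the division subring $L$ of $D$ generated by $S$ is finite-dimensional as a vector space over its own center $Z(L)$. Call $D$ locally PI if every finitely generated $F$-subalgebra $B$ of $D$ is a PI algebra over $F$, that is, there are a number $m$ of variables and a nonzero polynomial $f\in F\langle x_1,\dots,x_m\rangle$ in noncommuting variables (both possibly depending on $B$) such that $f(b_1,\dots,b_m)=0$ for all $b_1,\dots,b_m\in B$. Then $D$ is weakly locally finite if and only if $D$ is locally PI. -/

import Mathlib

/-- An algebra `A` over a field `k` is a PI algebra if some nonzero polynomial with coefficients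
in `k` in noncommuting variables `x₀, x₁, x₂, …` vanishes under every substitution of elements
of `A` for the variables. -/
def IsPIAlgebra (k A : Type*) [Field k] [Ring A] [Algebra k A] : Prop :=
  ∃ f : FreeAlgebra k ℕ, f ≠ 0 ∧ ∀ a : ℕ → A, FreeAlgebra.lift k a f = 0

/-- An algebra over a field `k` is locally PI if each of its finitely generated subalgebras is a
PI algebra over `k`. -/
def IsLocallyPIAlgebra (k A : Type*) [Field k] [Ring A] [Algebra k A] : Prop :=
  ∀ B : Subalgebra k A, B.FG → IsPIAlgebra k B

/-- A division ring is centrally finite if it is a finite-dimensional vector space over its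
center. -/
def IsCentrallyFinite (D : Type*) [DivisionRing D] : Prop :=
  FiniteDimensional (Subring.center D) D

/-- A division ring `D` is weakly locally finite if, for every finite subset `S`, the division
subring generated by `S` in `D` is centrally finite. (Mathlib's `Subfield` of a division ring is a
division subring, not assumed commutative.) -/
def IsWeaklyLocallyFinite (D : Type*) [DivisionRing D] : Prop :=
  ∀ S : Finset D, IsCentrallyFinite (Subfield.closure (S : Set D))

/-!
The passage from PI to finiteness is Kaplansky's theorem in the following form: if a submonoid `M`
generating the division ring `D` satisfies a nontrivial multilinear identity with coefficients in
`D`, then `D` is finite-dimensional over its center. Suppose it is not. Then an operator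
`x ↦ ∑ⱼ aⱼ * x * bⱼ` with `∑ⱼ aⱼ ⊗ bⱼ ≠ 0` has infinite rank on `M`, which forces the two sums in an
identity `∑ᵢ pᵢ * x * qᵢ * y * rᵢ + ∑ⱼ p'ⱼ * y * q'ⱼ * x * r'ⱼ = 0` to vanish separately. So the
monomials of a multilinear identity in which `x` precedes `y` form an identity by themselves;
iterating over all pairs of variables isolates a single monomial, whose coefficient must be zero.

Polynomial identities are multilinearized to bring them into this form. Conversely, a centrally
finite division ring satisfies a standard identity, which refers to no base field and is inherited
both by subrings and by algebras spanned by the ring over commuting scalars.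
-/

section FiniteRank

open scoped TensorProduct

/-- The values of `f` on `s` lie in a finite-dimensional subspace. In the applications `s` is a
submonoid generating a division ring, which need not be a subspace, so `f` is a mere function. -/
def HasFiniteRankOn (E : Type*) {X V : Type*} [Field E] [AddCommGroup V] [Module E V]
    (s : Set X) (f : X → V) : Prop :=
  ∃ W : Submodule E V, FiniteDimensional E W ∧ ∀ x ∈ s, f x ∈ W

namespace HasFiniteRankOn

variable {E X V V' : Type*} [Field E] [AddCommGroup V] [Module E V] [AddCommGroup V'] [Module E V']
  {s : Set X} {f g : X → V}

theorem congr (hf : HasFiniteRankOn E s f) (h : ∀ x ∈ s, f x = g x) : HasFiniteRankOn E s g := by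
  obtain ⟨W, hW, hfW⟩ := hf
  exact ⟨W, hW, fun x hx => h x hx ▸ hfW x hx⟩

theorem comp_mapsTo {Y : Type*} {t : Set Y} {φ : Y → X} (hf : HasFiniteRankOn E s f)
    (hφ : Set.MapsTo φ t s) : HasFiniteRankOn E t (f ∘ φ) := by
  obtain ⟨W, hW, hfW⟩ := hf
  exact ⟨W, hW, fun x hx => hfW _ (hφ hx)⟩

theorem map (hf : HasFiniteRankOn E s f) (T : V →ₗ[E] V') :
    HasFiniteRankOn E s fun x => T (f x) := by
  obtain ⟨W, hW, hfW⟩ := hf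
  exact ⟨W.map T, inferInstance, fun x hx => Submodule.mem_map_of_mem (hfW x hx)⟩

theorem sub (hf : HasFiniteRankOn E s f) (hg : HasFiniteRankOn E s g) :
    HasFiniteRankOn E s fun x => f x - g x := by
  obtain ⟨W, hW, hfW⟩ := hf
  obtain ⟨W', hW', hgW'⟩ := hg
  exact ⟨W ⊔ W', inferInstance, fun x hx => Submodule.sub_mem _
    (Submodule.mem_sup_left (hfW x hx)) (Submodule.mem_sup_right (hgW' x hx))⟩

theorem finiteDimensional {D : Type*} [DivisionRing D] [Algebra E D] {M : Submonoid D}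
    (hM : Subfield.closure (M : Set D) = ⊤) (h : HasFiniteRankOn E (M : Set D) id) :
    FiniteDimensional E D := by
  obtain ⟨W, hW, hMW⟩ := h
  let A := Algebra.adjoin E (M : Set D)
  have hA : Subalgebra.toSubmodule A ≤ W := by
    rw [Algebra.adjoin_eq_span, Submonoid.closure_eq]
    exact Submodule.span_le.2 hMW
  have : FiniteDimensional E A := Submodule.finiteDimensional_of_le hA
  let K : Subfield D := { A.toSubring with inv_mem' := fun _ hx => Algebra.IsIntegral.inv_mem hx }
  have hK : K = ⊤ := top_unique (hM ▸ Subfield.closure_le.2 Algebra.subset_adjoin)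
  have hAtop : A = ⊤ := eq_top_iff.2 fun x _ => show x ∈ K from hK ▸ Subfield.mem_top x
  exact Module.Finite.equiv
    ((Subalgebra.equivOfEq A ⊤ hAtop).trans Subalgebra.topEquiv).toLinearEquiv

end HasFiniteRankOn

theorem mem_center_of_forall_commute {D : Type*} [DivisionRing D] {s : Set D}
    (hs : Subfield.closure s = ⊤) {z : D} (hz : ∀ x ∈ s, Commute x z) : z ∈ Subring.center D := by
  refine Subring.mem_center_iff.2 fun x => ?_
  have hx : x ∈ Subfield.closure s := hs ▸ Subfield.mem_top x
  change Commute x z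
  induction hx using Subfield.closure_induction with
  | mem x hx => exact hz x hx
  | one => exact Commute.one_left z
  | add x y _ _ hx hy => exact hx.add_left hy
  | neg x _ hx => exact hx.neg_left
  | inv x _ hx => exact hx.inv_left₀
  | mul x y _ _ hx hy => exact hx.mul_left hy

theorem HasFiniteRankOn.sum_mul_mul_commutator {E A κ : Type*} [Field E] [Ring A] [Algebra E A]
    {M : Submonoid A} {s : Finset κ} {e b : κ → A}
    (h : HasFiniteRankOn E (M : Set A) fun x => ∑ k ∈ s, e k * x * b k) {y : A} (hy : y ∈ M) :
    HasFiniteRankOn E (M : Set A) fun x => ∑ k ∈ s, e k * x * (y * b k - b k * y) := by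
  refine ((h.comp_mapsTo (φ := (· * y)) fun x hx => M.mul_mem hx hy).sub
    (h.map (LinearMap.mulRight _ y))).congr fun x _ => ?_
  simp only [Function.comp_apply, LinearMap.mulRight_apply, Finset.sum_mul,
    ← Finset.sum_sub_distrib, mul_sub, mul_assoc]

/-- The linear map `a ⊗ b ↦ a * x * b`, through which elements `∑ⱼ aⱼ ⊗ bⱼ` of `D ⊗ D` act as the
operators `x ↦ ∑ⱼ aⱼ * x * bⱼ`. -/
noncomputable def sandwich (D : Type*) [DivisionRing D] (x : D) :
    D ⊗[Subring.center D] D →ₗ[Subring.center D] D :=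
  LinearMap.mul' _ D ∘ₗ (LinearMap.mulRight _ x).rTensor D

theorem sandwich_tmul {D : Type*} [DivisionRing D] (x a b : D) :
    sandwich D x (a ⊗ₜ b) = a * x * b := by
  simp [sandwich]

variable {D : Type*} [DivisionRing D] {M : Submonoid D}
  (hM : Subfield.closure (M : Set D) = ⊤) (hD : ¬ IsCentrallyFinite D)

include hM hD

theorem eq_zero_of_hasFiniteRankOn_mul_left {u : D}
    (h : HasFiniteRankOn (Subring.center D) (M : Set D) (u * ·)) : u = 0 := by
  by_contra hu
  refine hD (HasFiniteRankOn.finiteDimensional hM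
    ((h.map (LinearMap.mulLeft _ u⁻¹)).congr fun x _ => ?_))
  exact inv_mul_cancel_left₀ hu x

theorem eq_zero_of_hasFiniteRankOn_of_mem_center {κ : Type*} {e : κ → D}
    (he : LinearIndependent (Subring.center D) e) {s : Finset κ} (z : κ → Subring.center D)
    (h : HasFiniteRankOn (Subring.center D) (M : Set D) fun x => ∑ k ∈ s, e k * x * z k) :
    ∀ k ∈ s, z k = 0 := by
  refine linearIndependent_iff'.1 he s z (eq_zero_of_hasFiniteRankOn_mul_left hM hD
    (h.congr fun x _ => ?_))
  rw [Finset.sum_mul]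
  refine Finset.sum_congr rfl fun k _ => ?_
  rw [Subring.smul_def, smul_eq_mul, Subring.mem_center_iff.1 (z k).2, mul_assoc]

theorem eq_zero_of_hasFiniteRankOn_sum_mul_mul {κ : Type*} {e : κ → D}
    (he : LinearIndependent (Subring.center D) e) (s : Finset κ) (b : κ → D)
    (h : HasFiniteRankOn (Subring.center D) (M : Set D) fun x => ∑ k ∈ s, e k * x * b k) :
    ∀ k ∈ s, b k = 0 := by
  classical
  induction s using Finset.induction_on generalizing b with
  | empty => simp
  | insert i s hi ih =>
    have hbi : b i = 0 := by
      by_contra hbi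
      let b' := fun k => b k * (b i)⁻¹
      have hb'i : b' i = 1 := mul_inv_cancel₀ hbi
      have hb' : HasFiniteRankOn (Subring.center D) (M : Set D)
          fun x => ∑ k ∈ insert i s, e k * x * b' k :=
        (h.map (LinearMap.mulRight _ (b i)⁻¹)).congr fun x _ => by
          simp only [b', LinearMap.mulRight_apply, Finset.sum_mul, mul_assoc]
      -- Since `b' i = 1`, commutators with the coefficients give a shorter sum.
      have hcomm : ∀ k ∈ s, ∀ y ∈ M, Commute y (b' k) := fun k hk y hy =>
        sub_eq_zero.1 (ih (fun k => y * b' k - b' k * y)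
          ((hb'.sum_mul_mul_commutator hy).congr fun x _ => by
            rw [Finset.sum_insert hi, hb'i, mul_one, one_mul, sub_self, mul_zero, zero_add]) k hk)
      have hcenter : ∀ k ∈ insert i s, ∃ z : Subring.center D, (z : D) = b' k :=
        Finset.forall_mem_insert _ _ _ |>.2 ⟨⟨1, hb'i.symm⟩, fun k hk =>
          ⟨⟨_, mem_center_of_forall_commute hM (hcomm k hk)⟩, rfl⟩⟩
      choose! z hz using hcenter
      have hzi : z i = 0 := eq_zero_of_hasFiniteRankOn_of_mem_center hM hD he z
        (hb'.congr fun x _ => Finset.sum_congr rfl fun k hk => by rw [hz k hk])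
        i (Finset.mem_insert_self i s)
      have := hz i (Finset.mem_insert_self i s)
      rw [hzi, hb'i] at this
      exact zero_ne_one this
    refine Finset.forall_mem_insert _ _ _ |>.2 ⟨hbi, ih b (h.congr fun x _ => ?_)⟩
    rw [Finset.sum_insert hi, hbi, mul_zero, zero_add]

theorem eq_zero_of_hasFiniteRankOn_sandwich (t : D ⊗[Subring.center D] D)
    (h : HasFiniteRankOn (Subring.center D) (M : Set D) fun x => sandwich D x t) : t = 0 := by
  let e := Module.Basis.ofVectorSpace (Subring.center D) D
  obtain ⟨b, rfl⟩ := TensorProduct.eq_repr_basis_left e t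
  have hb := eq_zero_of_hasFiniteRankOn_sum_mul_mul hM hD e.linearIndependent b.support b
    (h.congr fun x _ => by simp only [Finsupp.sum, map_sum, sandwich_tmul])
  refine Finset.sum_eq_zero fun k hk => ?_
  simp only [hb k hk, TensorProduct.tmul_zero]

theorem sum_mul_mul_mul_mul_eq_zero {α β : Type*} (s : Finset α) (t : Finset β)
    (p q r : α → D) (p' q' r' : β → D)
    (h : ∀ x ∈ M, ∀ y ∈ M, ∑ i ∈ s, p i * x * q i * y * r i +
      ∑ j ∈ t, p' j * y * q' j * x * r' j = 0) (x y : D) :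
    ∑ j ∈ t, p' j * y * q' j * x * r' j = 0 := by
  classical
  let e := Module.Basis.ofVectorSpace (Subring.center D) D
  have hcoord (x : D) (k) :
      TensorProduct.equivFinsuppOfBasisLeft e
          (∑ j ∈ t, p' j ⊗ₜ[Subring.center D] (q' j * x * r' j)) k =
        sandwich D x (∑ j ∈ t, (e.repr (p' j) k • q' j) ⊗ₜ r' j) := by
    simp only [map_sum, Finsupp.finsetSum_apply, sandwich_tmul, smul_mul_assoc,
      TensorProduct.equivFinsuppOfBasisLeft_apply_tmul_apply]
  have htensor : ∀ x ∈ M, ∑ i ∈ s, (p i * x * q i) ⊗ₜ[Subring.center D] r i +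
      ∑ j ∈ t, p' j ⊗ₜ[Subring.center D] (q' j * x * r' j) = 0 := fun x hx =>
    eq_zero_of_hasFiniteRankOn_sandwich hM hD _ ⟨⊥, inferInstance, fun y hy => by
      simpa only [map_add, map_sum, sandwich_tmul, mul_assoc, Submodule.mem_bot]
        using h x hx y hy⟩
  -- The coordinates of the second sum lie in the span of the `r i`, independently of `x`.
  have hzero (k) : ∑ j ∈ t, (e.repr (p' j) k • q' j) ⊗ₜ[Subring.center D] r' j = 0 := by
    refine eq_zero_of_hasFiniteRankOn_sandwich hM hD _
      ⟨Submodule.span (Subring.center D) (s.image r : Set D), inferInstance, fun x hx => ?_⟩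
    beta_reduce
    rw [← hcoord, eq_neg_of_add_eq_zero_right (htensor x hx), ← Finset.sum_neg_distrib]
    simp only [map_sum, map_neg, Finsupp.finsetSum_apply, Finsupp.neg_apply,
      TensorProduct.equivFinsuppOfBasisLeft_apply_tmul_apply]
    refine Submodule.sum_mem _ fun i hi => Submodule.neg_mem _ (Submodule.smul_mem _ _
      (Submodule.subset_span (Finset.mem_image_of_mem r hi)))
  have hsum : ∑ j ∈ t, p' j ⊗ₜ[Subring.center D] (q' j * x * r' j) = 0 := by
    refine (TensorProduct.equivFinsuppOfBasisLeft e).map_eq_zero_iff.1 (Finsupp.ext fun k => ?_)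
    rw [hcoord, hzero, map_zero, Finsupp.zero_apply]
  simpa only [map_sum, map_zero, sandwich_tmul, mul_assoc] using congrArg (sandwich D y) hsum

end FiniteRank

section MultilinearPolynomial

open Equiv (Perm)

/-- The value at `a` of the multilinear polynomial `∑ σ, c σ x_{σ 0} ⋯ x_{σ (d - 1)}`. The
coefficients act on the left, so that they may be integers, scalars or ring elements. -/
def multilinearPoly {R A : Type*} [Semiring A] [SMul R A] {d : ℕ} (c : Perm (Fin d) → R)
    (a : Fin d → A) : A :=
  ∑ σ, c σ • (List.ofFn (a ∘ σ)).prod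

theorem map_multilinearPoly {k A B : Type*} [CommSemiring k] [Semiring A] [Semiring B]
    [Algebra k A] [Algebra k B] {d : ℕ} (φ : A →ₐ[k] B) (c : Perm (Fin d) → k) (a : Fin d → A) :
    φ (multilinearPoly c a) = multilinearPoly c (φ ∘ a) := by
  simp only [multilinearPoly, map_sum, map_smul, map_list_prod, List.map_ofFn, Function.comp_assoc]

theorem basisFreeMonoid_apply (k X : Type*) [CommSemiring k] (w : FreeMonoid X) :
    FreeAlgebra.basisFreeMonoid k X w = FreeMonoid.lift (FreeAlgebra.ι k) w := by
  simp [FreeAlgebra.basisFreeMonoid, FreeAlgebra.equivMonoidAlgebraFreeMonoid]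

theorem freeAlgebraLift_eq_sum_basisFreeMonoid_repr {k X A : Type*} [CommSemiring k] [Semiring A]
    [Algebra k A] (a : X → A) (f : FreeAlgebra k X) :
    FreeAlgebra.lift k a f =
      ((FreeAlgebra.basisFreeMonoid k X).repr f).sum fun w r => r • FreeMonoid.lift a w := by
  conv_lhs => rw [← (FreeAlgebra.basisFreeMonoid k X).linearCombination_repr f,
    Finsupp.linearCombination_apply, map_finsuppSum]
  simp only [basisFreeMonoid_apply, map_smul]
  congr! 3 with w r
  simp [FreeMonoid.lift_apply, map_list_prod, Function.comp_def]

theorem multilinearPoly_ι_eq_zero_iff {k X : Type*} [CommRing k] {d : ℕ} (c : Perm (Fin d) → k)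
    {x : Fin d → X} (hx : Function.Injective x) :
    multilinearPoly c (FreeAlgebra.ι k ∘ x) = 0 ↔ c = 0 := by
  let word (σ : Perm (Fin d)) : FreeMonoid X := FreeMonoid.ofList (List.ofFn (x ∘ σ))
  have hword : Function.Injective word := fun σ τ h =>
    DFunLike.coe_injective (hx.comp_left (List.ofFn_injective (FreeMonoid.ofList.injective h)))
  have hli := (FreeAlgebra.basisFreeMonoid k X).linearIndependent.comp word hword
  have hbasis (σ : Perm (Fin d)) : FreeAlgebra.basisFreeMonoid k X (word σ) =
      (List.ofFn ((FreeAlgebra.ι k ∘ x) ∘ σ)).prod := by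
    rw [basisFreeMonoid_apply, FreeMonoid.lift_ofList, List.map_ofFn, Function.comp_assoc]
  refine ⟨fun h => funext (Fintype.linearIndependent_iff.1 hli c ?_), ?_⟩
  · simpa only [multilinearPoly, Function.comp_apply, hbasis] using h
  · rintro rfl
    simp [multilinearPoly]

theorem isPIAlgebra_of_multilinearPoly_eq_zero {k A : Type*} [Field k] [Ring A] [Algebra k A]
    {d : ℕ} {c : Perm (Fin d) → k} (hc : c ≠ 0) (h : ∀ a : Fin d → A, multilinearPoly c a = 0) :
    IsPIAlgebra k A := by
  refine ⟨multilinearPoly c (FreeAlgebra.ι k ∘ Fin.val),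
    mt (multilinearPoly_ι_eq_zero_iff c Fin.val_injective).1 hc, fun a => ?_⟩
  rw [map_multilinearPoly, h]

end MultilinearPolynomial

section Multilinearization

open Equiv (Perm)

/-- Inclusion-exclusion over the set `T` of omitted summands keeps exactly the terms in which every
summand occurs. -/
theorem sum_neg_one_pow_card_smul_map_sum_sdiff {R κ ι V W : Type*} [Semiring R]
    [AddCommMonoid V] [Module R V] [AddCommGroup W] [Module R W] [Fintype κ] [DecidableEq κ]
    [Fintype ι] [DecidableEq ι] (g : MultilinearMap R (fun _ : κ => V) W) (s : κ → Finset ι)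
    (a : ι → V) :
    ∑ T : Finset ι, (-1 : ℤ) ^ T.card • g (fun m => ∑ j ∈ s m \ T, a j) =
      ∑ r ∈ Fintype.piFinset s with Function.Surjective r, g (a ∘ r) := by
  have hpi (T : Finset ι) : Fintype.piFinset (fun m => s m \ T) =
      {r ∈ Fintype.piFinset s | T ⊆ (Finset.univ.image r)ᶜ} := by
    ext r
    simp only [Fintype.mem_piFinset, Finset.mem_sdiff, Finset.mem_filter, forall_and,
      Finset.subset_compl_comm (s := T), Finset.image_subset_iff, Finset.mem_univ,
      Finset.mem_compl, true_implies]
  have hsurj (r : κ → ι) : (Finset.univ.image r)ᶜ = ∅ ↔ Function.Surjective r := by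
    simp [Finset.eq_univ_iff_forall, Function.Surjective]
  calc
    _ = ∑ T : Finset ι, ∑ r ∈ Fintype.piFinset s,
          if T ⊆ (Finset.univ.image r)ᶜ then (-1 : ℤ) ^ T.card • g (a ∘ r) else 0 := by
      simp only [g.map_sum_finset (fun _ => a), hpi, Finset.smul_sum, Finset.sum_filter,
        smul_ite, smul_zero]
      rfl
    _ = ∑ r ∈ Fintype.piFinset s,
          (∑ T ∈ (Finset.univ.image r)ᶜ.powerset, (-1 : ℤ) ^ T.card) • g (a ∘ r) := by
      rw [Finset.sum_comm]
      simp only [Finset.sum_smul, ← Finset.sum_filter, ← Finset.mem_powerset,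
        Finset.filter_univ_mem]
    _ = _ := by
      simp only [Finset.sum_powerset_neg_one_pow_card, hsurj, ite_smul, one_smul, zero_smul,
        Finset.sum_filter]

theorem sum_surjective_eq_sum_perm {W : Type*} [AddCommMonoid W] {d : ℕ}
    (p : (Fin d → Fin d) → Prop) [DecidablePred p] (g : (Fin d → Fin d) → W) :
    ∑ r with p r ∧ Function.Surjective r, g r = ∑ σ ∈ {σ : Perm (Fin d) | p σ}, g σ := by
  refine (Finset.sum_bij (fun (σ : Perm (Fin d)) _ => ⇑σ) ?_
    (fun _ _ _ _ h => DFunLike.coe_injective h) ?_ fun _ _ => rfl).symm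
  · intro σ hσ
    exact Finset.mem_filter_univ _ |>.2 ⟨Finset.mem_filter_univ σ |>.1 hσ, σ.surjective⟩
  · intro r hr
    obtain ⟨hp, hr⟩ := Finset.mem_filter_univ _ |>.1 hr
    exact ⟨.ofBijective r (Finite.surjective_iff_bijective.1 hr),
      Finset.mem_filter_univ _ |>.2 hp, rfl⟩

theorem sum_neg_one_pow_card_smul_lift {A X : Type*} [Ring A] [DecidableEq X] {d : ℕ}
    (v : Fin d → X) (a : Fin d → A) (w : FreeMonoid X) (hw : w.length ≤ d) :
    ∑ T : Finset (Fin d), (-1 : ℤ) ^ T.card •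
        FreeMonoid.lift (fun x => ∑ j ∈ ({j | v j = x} : Finset (Fin d)) \ T, a j) w =
      ∑ σ ∈ {σ : Perm (Fin d) | List.ofFn (v ∘ σ) = w.toList}, (List.ofFn (a ∘ σ)).prod := by
  obtain ⟨n, u, rfl⟩ : ∃ n, ∃ u : Fin n → X, FreeMonoid.ofList (List.ofFn u) = w :=
    ⟨_, w.toList.get, List.ofFn_get _⟩
  have hlift (b : X → A) : FreeMonoid.lift b (FreeMonoid.ofList (List.ofFn u)) =
      MultilinearMap.mkPiAlgebraFin ℤ n A (b ∘ u) := by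
    rw [FreeMonoid.lift_ofList, List.map_ofFn, MultilinearMap.mkPiAlgebraFin_apply]
  simp only [hlift]
  refine (sum_neg_one_pow_card_smul_map_sum_sdiff (MultilinearMap.mkPiAlgebraFin ℤ n A)
    (fun m => ({j | v j = u m} : Finset (Fin d))) a).trans ?_
  replace hw : n ≤ d := by simpa [FreeMonoid.length] using hw
  obtain hlt | rfl := hw.lt_or_eq
  · rw [Finset.filter_false_of_mem, Finset.filter_false_of_mem]
    · rw [Finset.sum_empty, Finset.sum_empty]
    · intro σ _ h
      simpa [hlt.ne'] using congrArg List.length h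
    · intro r _ hr
      simpa [hlt.not_ge] using Fintype.card_le_of_surjective r hr
  · have hpi : Fintype.piFinset (fun m => ({j | v j = u m} : Finset (Fin n))) =
        ({r | List.ofFn (v ∘ r) = List.ofFn u} : Finset (Fin n → Fin n)) := by
      ext r
      simp [List.ofFn_inj, funext_iff]
    rw [hpi, Finset.filter_filter]
    exact sum_surjective_eq_sum_perm (fun r => List.ofFn (v ∘ r) = List.ofFn u)
      (fun r => (List.ofFn (a ∘ r)).prod)

/-- The left-hand side is the full polarization of `f` along the word `v`; it retains only the
monomials of `f` that are rearrangements of `v`. -/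
theorem sum_neg_one_pow_card_smul_freeAlgebraLift {k A X : Type*} [CommSemiring k] [Ring A]
    [Algebra k A] [DecidableEq X] {d : ℕ} (v : Fin d → X) (a : Fin d → A) (f : FreeAlgebra k X)
    (hf : ∀ w ∈ ((FreeAlgebra.basisFreeMonoid k X).repr f).support, w.length ≤ d) :
    ∑ T : Finset (Fin d), (-1 : ℤ) ^ T.card •
        FreeAlgebra.lift k (fun x => ∑ j ∈ ({j | v j = x} : Finset (Fin d)) \ T, a j) f =
      multilinearPoly (fun σ : Perm (Fin d) => (FreeAlgebra.basisFreeMonoid k X).repr f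
        (FreeMonoid.ofList (List.ofFn (v ∘ σ)))) a := by
  let coeff := (FreeAlgebra.basisFreeMonoid k X).repr f
  calc
    _ = ∑ w ∈ coeff.support, coeff w • ∑ T : Finset (Fin d), (-1 : ℤ) ^ T.card •
        FreeMonoid.lift (fun x => ∑ j ∈ ({j | v j = x} : Finset (Fin d)) \ T, a j) w := by
      simp only [freeAlgebraLift_eq_sum_basisFreeMonoid_repr, Finsupp.sum, Finset.smul_sum]
      rw [Finset.sum_comm]
      simp only [smul_comm (_ : k), coeff]
    _ = ∑ w ∈ coeff.support, coeff w •
        ∑ σ ∈ {σ : Perm (Fin d) | List.ofFn (v ∘ σ) = w.toList}, (List.ofFn (a ∘ σ)).prod :=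
      Finset.sum_congr rfl fun w hw => by rw [sum_neg_one_pow_card_smul_lift v a w (hf w hw)]
    _ = _ := by
      simp only [Finset.smul_sum, Finset.sum_filter]
      rw [Finset.sum_comm]
      refine Finset.sum_congr rfl fun σ _ => ?_
      rw [Finset.sum_eq_single (FreeMonoid.ofList (List.ofFn (v ∘ σ)))]
      · rw [FreeMonoid.toList_ofList, if_pos rfl]
      · intro w _ hw
        rw [if_neg fun h => hw (FreeMonoid.toList.injective h.symm), smul_zero]
      · intro h
        rw [Finsupp.notMem_support_iff.1 h, zero_smul]

theorem IsPIAlgebra.exists_multilinearPoly_eq_zero {k A : Type*} [Field k] [Ring A] [Algebra k A]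
    (h : IsPIAlgebra k A) :
    ∃ (d : ℕ) (c : Perm (Fin d) → k), c ≠ 0 ∧ ∀ a : Fin d → A, multilinearPoly c a = 0 := by
  obtain ⟨f, hf, hfA⟩ := h
  let coeff := (FreeAlgebra.basisFreeMonoid k ℕ).repr f
  have hcoeff : coeff.support.Nonempty := Finsupp.support_nonempty_iff.2
    (mt (LinearEquiv.map_eq_zero_iff _).1 hf)
  obtain ⟨w₀, hw₀, hmax⟩ := coeff.support.exists_max_image FreeMonoid.length hcoeff
  let v : Fin w₀.length → ℕ := w₀.toList.get
  let c (σ : Perm (Fin w₀.length)) : k := coeff (FreeMonoid.ofList (List.ofFn (v ∘ σ)))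
  refine ⟨w₀.length, c, fun hc => Finsupp.mem_support_iff.1 hw₀ ?_, fun a => ?_⟩
  · have hw₀v : FreeMonoid.ofList (List.ofFn v) = w₀ := List.ofFn_get _
    simpa [c, hw₀v] using congrFun hc 1
  · rw [← sum_neg_one_pow_card_smul_freeAlgebraLift v a f hmax]
    simp only [hfA, smul_zero, Finset.sum_const_zero]

end Multilinearization

section Kaplansky

open Equiv (Perm)

theorem listOfFn_update {α : Type*} {d : ℕ} (b : Fin d → α) (m : Fin d) (x : α) :
    List.ofFn (Function.update b m x) = (List.ofFn b).set m x := by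
  refine List.ext_getElem (by simp) fun i _ _ => ?_
  simp [List.getElem_set, Function.update_apply, Fin.ext_iff, eq_comm]

theorem exists_prod_ofFn_update_update {N : Type*} [Monoid N] {d : ℕ} (b : Fin d → N)
    {m n : Fin d} (hmn : m < n) :
    ∃ p q r, ∀ x y, (List.ofFn (Function.update (Function.update b m x) n y)).prod =
      p * x * q * y * r := by
  refine ⟨(((List.ofFn b).take n).take m).prod, (((List.ofFn b).take n).drop (m + 1)).prod,
    ((List.ofFn b).drop (n + 1)).prod, fun x y => ?_⟩
  rw [listOfFn_update, listOfFn_update, List.prod_set, List.take_set, List.prod_set,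
    List.drop_set_of_lt (by omega), if_pos (by simpa using hmn),
    if_pos (by simp)]

theorem exists_prod_ofFn_update_update_comp {N : Type*} [Monoid N] {d : ℕ} (a : Fin d → N)
    {σ : Perm (Fin d)} {i j : Fin d} (hij : σ.symm i < σ.symm j) :
    ∃ p q r, ∀ x y, (List.ofFn (Function.update (Function.update a i x) j y ∘ σ)).prod =
      p * x * q * y * r := by
  simpa only [Function.update_comp_equiv] using exists_prod_ofFn_update_update (a ∘ σ) hij

theorem eq_of_forall_symm_lt_symm {d : ℕ} {σ τ : Perm (Fin d)}
    (h : ∀ i j, σ.symm i < σ.symm j → τ.symm i < τ.symm j) : σ = τ := by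
  have hmono : StrictMono (σ.trans τ.symm) := fun i j hij =>
    h _ _ (by rwa [σ.symm_apply_apply, σ.symm_apply_apply])
  have hone : σ.trans τ.symm = 1 := (Equiv.Perm.monotone_iff _).1 hmono.monotone
  ext i
  rw [← τ.apply_symm_apply (σ i)]
  exact congrArg (fun ρ : Perm (Fin d) => (τ (ρ i) : ℕ)) hone

variable {D : Type*} [DivisionRing D] {M : Submonoid D} {d : ℕ}

theorem sum_filter_symm_lt_symm_eq_zero (hM : Subfield.closure (M : Set D) = ⊤)
    (hD : ¬ IsCentrallyFinite D) (c : Perm (Fin d) → D) {W : Finset (Perm (Fin d))}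
    (h : ∀ a : Fin d → D, (∀ i, a i ∈ M) → ∑ σ ∈ W, c σ * (List.ofFn (a ∘ σ)).prod = 0)
    {i j : Fin d} (hij : i ≠ j) {a : Fin d → D} (ha : ∀ i, a i ∈ M) :
    ∑ σ ∈ W with σ.symm i < σ.symm j, c σ * (List.ofFn (a ∘ σ)).prod = 0 := by
  have hlt (σ) (hσ : σ ∈ ({σ ∈ W | σ.symm i < σ.symm j} : Finset (Perm (Fin d)))) :=
    exists_prod_ofFn_update_update_comp a (Finset.mem_filter.1 hσ).2
  have hge (σ) (hσ : σ ∈ ({σ ∈ W | ¬ σ.symm i < σ.symm j} : Finset (Perm (Fin d)))) :=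
    exists_prod_ofFn_update_update_comp a
      ((not_lt.1 (Finset.mem_filter.1 hσ).2).lt_of_ne (σ.symm.injective.ne hij.symm))
  choose! p' q' r' hpqr' using hlt
  choose! p q r hpqr using hge
  have hzero := sum_mul_mul_mul_mul_eq_zero hM hD {σ ∈ W | ¬ σ.symm i < σ.symm j}
    {σ ∈ W | σ.symm i < σ.symm j} (fun σ => c σ * p σ) q r (fun σ => c σ * p' σ) q' r'
    (fun x hx y hy => ?_) (a j) (a i)
  · rw [← hzero]
    refine Finset.sum_congr rfl fun σ hσ => ?_
    simpa only [Function.update_eq_self, mul_assoc]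
      using congrArg (c σ * ·) (hpqr' σ hσ (a i) (a j))
  · let b := Function.update (Function.update a j x) i y
    have hb (m) : b m ∈ M := by
      simp only [b, Function.update_apply]
      split_ifs
      exacts [hy, hx, ha m]
    rw [← h b hb, ← Finset.sum_filter_not_add_sum_filter W (fun σ => σ.symm i < σ.symm j)]
    congr 1 <;> refine Finset.sum_congr rfl fun σ hσ => ?_
    · rw [hpqr σ hσ]
      simp only [mul_assoc]
    · rw [show b = _ from Function.update_comm hij.symm .., hpqr' σ hσ]
      simp only [mul_assoc]

theorem eq_zero_of_forall_sum_mul_prod_ofFn_eq_zero (hM : Subfield.closure (M : Set D) = ⊤)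
    (hD : ¬ IsCentrallyFinite D) (c : Perm (Fin d) → D) (W : Finset (Perm (Fin d)))
    (h : ∀ a : Fin d → D, (∀ i, a i ∈ M) → ∑ σ ∈ W, c σ * (List.ofFn (a ∘ σ)).prod = 0) :
    ∀ σ ∈ W, c σ = 0 := by
  induction W using Finset.strongInduction with | H W ih
  intro σ hσ
  by_cases hW : ∀ τ ∈ W, σ = τ
  · have h1 := h 1 fun _ => M.one_mem
    rw [Finset.eq_singleton_iff_unique_mem.2 ⟨hσ, fun τ hτ => (hW τ hτ).symm⟩] at h1
    simpa [Pi.one_comp, Pi.one_def] using h1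
  · push Not at hW
    obtain ⟨τ, hτ, hne⟩ := hW
    obtain ⟨i, j, hσij, hτij⟩ : ∃ i j, σ.symm i < σ.symm j ∧ ¬ τ.symm i < τ.symm j := by
      by_contra! hcon
      exact hne (eq_of_forall_symm_lt_symm hcon)
    exact ih _ (Finset.filter_ssubset.2 ⟨τ, hτ, hτij⟩)
      (fun a => sum_filter_symm_lt_symm_eq_zero hM hD c h
        (ne_of_apply_ne σ.symm hσij.ne)) σ (Finset.mem_filter.2 ⟨hσ, hσij⟩)

theorem isCentrallyFinite_of_multilinearPoly_eq_zero (hM : Subfield.closure (M : Set D) = ⊤)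
    {c : Perm (Fin d) → D} (hc : c ≠ 0)
    (h : ∀ a : Fin d → D, (∀ i, a i ∈ M) → multilinearPoly c a = 0) : IsCentrallyFinite D := by
  by_contra hD
  exact hc (funext fun σ =>
    eq_zero_of_forall_sum_mul_prod_ofFn_eq_zero hM hD c Finset.univ h σ (Finset.mem_univ σ))

theorem IsPIAlgebra.isCentrallyFinite {k A : Type*} [Field k] [Ring A] [Algebra k A]
    (h : IsPIAlgebra k A) (ρ : A →+* D) (hρ : Subfield.closure (Set.range ρ) = ⊤) :
    IsCentrallyFinite D := by
  obtain ⟨d, c, hc, hcA⟩ := h.exists_multilinearPoly_eq_zero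
  refine isCentrallyFinite_of_multilinearPoly_eq_zero (M := MonoidHom.mrange ρ)
    (c := fun σ => ρ (algebraMap k A (c σ))) hρ (mt (fun h => funext fun σ => ?_) hc)
    fun a ha => ?_
  · exact (map_eq_zero (ρ.comp (algebraMap k A))).1 (congrFun h σ)
  · choose b hb using ha
    obtain rfl : ρ ∘ b = a := funext hb
    have := congrArg ρ (hcA b)
    simpa only [multilinearPoly, map_sum, Algebra.smul_def, map_mul, map_list_prod, List.map_ofFn,
      Function.comp_assoc, smul_eq_mul, map_zero] using this

end Kaplansky

section StandardIdentity

open Equiv (Perm)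

/-- The standard identity `∑ σ, sign σ • x_{σ 0} ⋯ x_{σ (n - 1)} = 0` of degree `n`. It makes no
reference to a base field, so it carries over between division rings with different centers. -/
def SatisfiesStandardIdentity (n : ℕ) (A : Type*) [Ring A] : Prop :=
  ∀ a : Fin n → A, multilinearPoly (fun σ => (Perm.sign σ : ℤ)) a = 0

theorem multilinearPoly_sign (k : Type*) {A : Type*} [CommRing k] [Ring A] [Algebra k A] {n : ℕ}
    (a : Fin n → A) : multilinearPoly (fun σ => (Perm.sign σ : ℤ)) a =
      MultilinearMap.alternatization (MultilinearMap.mkPiAlgebraFin k n A) a := by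
  rw [MultilinearMap.alternatization_apply]
  rfl

theorem satisfiesStandardIdentity_of_finrank_lt {E A : Type*} [Field E] [Ring A] [Algebra E A]
    [FiniteDimensional E A] {n : ℕ} (hn : Module.finrank E A < n) :
    SatisfiesStandardIdentity n A := fun a => by
  rw [multilinearPoly_sign E]
  refine AlternatingMap.map_linearDependent _ _ fun ha => ?_
  simpa [hn.not_ge] using ha.fintype_card_le_finrank

namespace SatisfiesStandardIdentity

variable {n : ℕ} {A B : Type*} [Ring A] [Ring B]

theorem of_injective (h : SatisfiesStandardIdentity n B) {φ : A →+* B}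
    (hφ : Function.Injective φ) : SatisfiesStandardIdentity n A := fun a =>
  hφ (by rw [← RingHom.toIntAlgHom_apply, map_multilinearPoly, h, map_zero])

theorem of_span_range_eq_top (h : SatisfiesStandardIdentity n A) {k : Type*} [CommRing k]
    [Algebra k B] (φ : A →+* B) (hφ : Submodule.span k (Set.range φ) = ⊤) :
    SatisfiesStandardIdentity n B := fun b => by
  rw [multilinearPoly_sign k]
  suffices MultilinearMap.alternatization (MultilinearMap.mkPiAlgebraFin k n B) = 0 by
    rw [this, AlternatingMap.zero_apply]
  refine AlternatingMap.coe_multilinearMap_injective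
    (MultilinearMap.ext_of_span_eq_top (g := fun _ => φ) (fun _ => hφ) fun a => ?_)
  have := congrArg φ (h a)
  rw [← RingHom.toIntAlgHom_apply, map_multilinearPoly, map_zero, multilinearPoly_sign k] at this
  exact this

theorem adjoin {k : Type*} [CommRing k] [Algebra k A] {R : Subring A}
    (h : SatisfiesStandardIdentity n R) :
    SatisfiesStandardIdentity n (Algebra.adjoin k (R : Set A)) := by
  let S := Algebra.adjoin k (R : Set A)
  let φ : R →+* S := R.subtype.codRestrict S fun x => Algebra.subset_adjoin x.2
  refine h.of_span_range_eq_top (k := k) φ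
    (Submodule.map_injective_of_injective (f := S.val.toLinearMap) Subtype.val_injective ?_)
  have hφ : Set.range (S.val ∘ φ) = (R.toSubmonoid : Set A) := Subtype.range_coe
  calc
    _ = Submodule.span k (Set.range (S.val ∘ φ)) := by
      rw [Submodule.map_span, ← Set.range_comp]
      rfl
    _ = Subalgebra.toSubmodule S := by
      rw [hφ, Algebra.adjoin_eq_span, ← Submonoid.closure_eq R.toSubmonoid]
      rfl
    _ = Submodule.map S.val.toLinearMap ⊤ := by
      rw [Submodule.map_top]
      exact (Submodule.range_subtype _).symm

theorem isPIAlgebra (h : SatisfiesStandardIdentity n A) (k : Type*) [Field k] [Algebra k A] :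
    IsPIAlgebra k A := by
  refine isPIAlgebra_of_multilinearPoly_eq_zero
    (c := fun σ : Perm (Fin n) => ((Perm.sign σ : ℤ) : k)) (fun hc => ?_) fun a => ?_
  · simpa using congrFun hc 1
  · simpa only [multilinearPoly, Int.cast_smul_eq_zsmul] using h a

end SatisfiesStandardIdentity

theorem IsCentrallyFinite.exists_satisfiesStandardIdentity {D : Type*} [DivisionRing D]
    (h : IsCentrallyFinite D) : ∃ n, SatisfiesStandardIdentity n D :=
  have : FiniteDimensional (Subring.center D) D := h
  ⟨_, satisfiesStandardIdentity_of_finrank_lt (E := Subring.center D) (Nat.lt_succ_self _)⟩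

end StandardIdentity

section WeaklyLocallyFinite

variable {D : Type*} [DivisionRing D]

theorem subfieldClosure_closure_coe_preimage (s : Set D) :
    Subfield.closure ((↑) ⁻¹' s : Set (Subfield.closure s)) = ⊤ := by
  refine Function.LeftInverse.injective (Subfield.comap_map (Subfield.closure s).subtype) ?_
  rw [RingHom.map_field_closure, ← RingHom.fieldRange_eq_map, Subfield.fieldRange_subtype]
  congr 1
  exact Set.image_preimage_eq_of_subset (Subtype.range_coe.symm ▸ Subfield.subset_closure)

theorem IsWeaklyLocallyFinite.isLocallyPIAlgebra (h : IsWeaklyLocallyFinite D) :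
    IsLocallyPIAlgebra (Subring.center D) D := by
  rintro _ ⟨S, rfl⟩
  obtain ⟨n, hn⟩ := (h S).exists_satisfiesStandardIdentity
  have hadjoin : SatisfiesStandardIdentity n
      (Algebra.adjoin (Subring.center D) (Subfield.closure (S : Set D) : Set D)) :=
    SatisfiesStandardIdentity.adjoin (R := (Subfield.closure (S : Set D)).toSubring) hn
  exact (hadjoin.of_injective (Subalgebra.inclusion_injective
    (Algebra.adjoin_mono Subfield.subset_closure))).isPIAlgebra _

theorem IsPIAlgebra.isCentrallyFinite_closure {k : Type*} [Field k] [Algebra k D]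
    {B : Subalgebra k D} (h : IsPIAlgebra k B) :
    IsCentrallyFinite (Subfield.closure (B : Set D)) := by
  refine h.isCentrallyFinite (B.subtype.codRestrict _ fun x => Subfield.subset_closure x.2) ?_
  convert subfieldClosure_closure_coe_preimage (B : Set D)
  ext x
  exact ⟨by rintro ⟨b, rfl⟩; exact b.2, fun hx => ⟨⟨x, hx⟩, rfl⟩⟩

theorem IsCentrallyFinite.of_ringHom {K L : Type*} [DivisionRing K] [DivisionRing L]
    (h : IsCentrallyFinite K) (φ : L →+* K) : IsCentrallyFinite L := by
  obtain ⟨n, hn⟩ := h.exists_satisfiesStandardIdentity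
  refine ((hn.of_injective φ.injective).isPIAlgebra (Subring.center L)).isCentrallyFinite
    (RingHom.id L) ?_
  rw [RingHom.coe_id, Set.range_id, Subfield.closure_univ]

theorem IsLocallyPIAlgebra.isWeaklyLocallyFinite
    (h : IsLocallyPIAlgebra (Subring.center D) D) : IsWeaklyLocallyFinite D := fun S =>
  (h _ ⟨S, rfl⟩).isCentrallyFinite_closure.of_ringHom
    (Subfield.inclusion (Subfield.closure_mono Algebra.subset_adjoin))

end WeaklyLocallyFinite

/-- A division ring is weakly locally finite if and only if it is locally PI as an algebra over
its center. -/
theorem theorem2p2 (D : Type*) [DivisionRing D] :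
    IsWeaklyLocallyFinite D ↔ IsLocallyPIAlgebra (Subring.center D) D :=
  ⟨IsWeaklyLocallyFinite.isLocallyPIAlgebra, IsLocallyPIAlgebra.isWeaklyLocallyFinite⟩
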